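/- Let $N,M,K$ be nonnegative integers and let $x\in\mathbb R^N$ be a nonnegative signal, $x_t\ge 0$ for all $t$, with exactly $K$ nonzero coordinates. Let $0<\gamma\le 1$ and $\epsilon>0$. For each $\alpha\in(0,1)$ let $(s_{tj})_{t\le N,\,j\le M}$ and $(r_{tj})_{t\le N,\,j\le M}$ be random variables, all of them mutually independent, such that each $s_{tj}$ has the maximally skewed $\alpha$-stable law $S(\alpha,1,1)$ of unit scale, i.e. the law with characteristic function $$\mathbb E\, e^{\sqrt{-1}\,\theta s_{tj}}=\exp\!\Big(-|\theta|^{\alpha}\big(1-\sqrt{-1}\,\operatorname{sign}(\theta)\tan(\pi\alpha/2)\big)\Big),\qquad \theta\in\mathbb R,$$ and $\Pr(r_{tj}=1)=\gamma=1-\Pr(r_{tj}=0)$. Put $$y_j=\sum_{t=1}^N x_t s_{tj}r_{tj}\quad(1\le j\le M),\qquad T_i=\{j:\ r_{ij}=1\},\qquad \hat x_{i,\min,\gamma}=\min_{j\in T_i}\frac{y_j}{s_{ij}r_{ij}},$$ where the minimum over the empty set is $+\infty$. Then, for every $1\le i\le N$, $$\lim_{\alpha\to0+}\Pr\left(\hat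 x_{i,\min,\gamma}>x_i+\epsilon\right)=\left[1-\frac{1}{K+1_{x_i=0}}\left(1-(1-\gamma)^{K+1_{x_i=0}}\right)\right]^M,$$ and $$\left[1-\frac{1}{K+1_{x_i=0}}\left(1-(1-\gamma)^{K+1_{x_i=0}}\right)\right]^M\le\left[1-\frac{1}{K+1}\left(1-(1-\gamma)^{K+1}\right)\right]^M\le\left[1-\frac{1}{1/\gamma+K}\right]^M,$$ where $1_{x_i=0}$ equals $1$ if $x_i=0$ and $0$ otherwise. -/

import Mathlib

open MeasureTheory ProbabilityTheory Filter Topology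

noncomputable section

/-- The maximally skewed (skewness `1`) stable law `S(α, 1, 1)` of unit scale, for `0 < α < 1`:
the law on `ℝ` with characteristic function
`t ↦ exp (-|t| ^ α * (1 - i * sign t * tan (π * α / 2)))`. -/
def IsStableLaw (α : ℝ) (μ : Measure ℝ) : Prop :=
  IsProbabilityMeasure μ ∧
    ∀ t : ℝ, charFun μ t =
      Complex.exp (-((|t| ^ α : ℝ) : ℂ) *
        (1 - Complex.I * ((Real.sign t * Real.tan (Real.pi * α / 2) : ℝ) : ℂ)))

/-- The random arrays `s` (stable entries) and `r` (zero-one mask) of a very sparse stable design: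
`s i j ∼ S(α, 1, 1)`, `r i j ∼ Bernoulli(γ)`, and all the `2 N M` variables are mutually
independent. -/
structure IsSparseStableDesign {Ω : Type*} [MeasurableSpace Ω] (P : Measure Ω) (α γ : ℝ)
    {N M : ℕ} (s r : Fin N → Fin M → Ω → ℝ) : Prop where
  measurable_s : ∀ i j, Measurable (s i j)
  measurable_r : ∀ i j, Measurable (r i j)
  law_s : ∀ i j, IsStableLaw α (P.map (s i j))
  prob_r_one : ∀ i j, P.real {ω | r i j ω = 1} = γ
  prob_r_zero : ∀ i j, P.real {ω | r i j ω = 0} = 1 - γ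
  indep : iIndepFun
    (Sum.elim (fun p : Fin N × Fin M => s p.1 p.2) (fun p : Fin N × Fin M => r p.1 p.2)) P

/-- The measurement `y_j = ∑ t, x_t s_{tj} r_{tj}`; `s` and `r` are realised arrays. -/
def measurement {N M : ℕ} (x : Fin N → ℝ) (s r : Fin N → Fin M → ℝ) (j : Fin M) : ℝ :=
  ∑ t, x t * (s t j * r t j)

/-- The set `T_i` of columns in which the `i`-th row of the design has a nonzero mask. -/
def maskSupport {N M : ℕ} (r : Fin N → Fin M → ℝ) (i : Fin N) : Set (Fin M) :=
  {j | r i j = 1}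

/-- The minimum estimator `min_{j ∈ T_i} y_j / (s_{ij} r_{ij})`, with the convention that
the minimum over the empty set is `+∞`. -/
def minEstimator {N M : ℕ} (x : Fin N → ℝ) (s r : Fin N → Fin M → ℝ) (i : Fin N) : EReal :=
  ⨅ j ∈ maskSupport r i, ((measurement x s r j / (s i j * r i j) : ℝ) : EReal)

/-- The error probability `Pr (x̂_i > x_i + ε)` of the minimum estimator of `x_i`. -/
def errorProb {Ω : Type*} [MeasurableSpace Ω] (P : Measure Ω) {N M : ℕ} (x : Fin N → ℝ)
    (s r : Fin N → Fin M → Ω → ℝ) (i : Fin N) (ε : ℝ) : ℝ :=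
  P.real {ω | ((x i + ε : ℝ) : EReal) <
    minEstimator x (fun t j => s t j ω) (fun t j => r t j ω) i}

/-- The number of nonzero coordinates of a signal. -/
def sparsity {N : ℕ} (x : Fin N → ℝ) : ℕ :=
  (Finset.univ.filter fun t => x t ≠ 0).card

end

/-! Columns are independent, so the error probability is the product over `j` of one minus the
probability that column `j` has `r i j = 1` and ratio at most `x i + ε`. In one column let `A` be
the set of `t ≠ i` with `x t ≠ 0` and mask 1. As `s i j > 0` almost surely, the ratio is at most `x
i + ε` exactly when `Z = ∑ t ∈ A, x t * s t j - ε * s i j ≤ 0`.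

`Z` is strictly stable with skewness `β = (∑ x t ^ α - ε ^ α) / (∑ x t ^ α + ε ^ α)`, and
`measureReal_Iic_zero_of_charFun_eq` gives the exact value `P (Z ≤ 0) = 1/2 - arctan (β tan (πα/2))
/ (πα)`. That formula comes from the sign inversion `integral_im_charFun_div`, the substitution `u =
θ ^ α` and the Laplace transform of `sin (b u) / u`. When `α → 0+` all powers tend to 1, so `β → (k
- 1)/(k + 1)` with `k = |A|`, and the probability tends to `1/(k + 1)`: neither `ε` nor the sizes of
the `x t` survive. Averaging over the binomial number of active interferers
(`sum_powerset_binomial_div`) gives the limit. -/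

/-! ### Laplace transforms of cosine and of `sin (b x) / x` -/

open Set in
lemma integrableOn_exp_neg_mul_sin_div {a : ℝ} (ha : 0 < a) (b : ℝ) :
    IntegrableOn (fun x : ℝ => Real.exp (-a * x) * (Real.sin (b * x) / x)) (Ioi 0) := by
  have h1 : IntegrableOn (fun x : ℝ => |b| * Real.exp (-a * x)) (Ioi 0) :=
    (integrableOn_exp_mul_Ioi (by linarith) 0).const_mul |b|
  refine h1.mono' (by fun_prop) ((ae_restrict_iff' measurableSet_Ioi).2 (ae_of_all _ ?_))
  intro x (hx : 0 < x)
  rw [norm_mul, Real.norm_eq_abs, Real.norm_eq_abs, abs_of_pos (Real.exp_pos _), mul_comm,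
    abs_div, abs_of_pos hx]
  gcongr
  rw [div_le_iff₀ hx]
  calc |Real.sin (b * x)| ≤ |b * x| := Real.abs_sin_le_abs
    _ = |b| * x := by rw [abs_mul, abs_of_pos hx]

open Set in
lemma integral_exp_neg_mul_cos {a : ℝ} (ha : 0 < a) (b : ℝ) :
    ∫ x in Ioi (0 : ℝ), Real.exp (-a * x) * Real.cos (b * x) = a / (a ^ 2 + b ^ 2) := by
  have hre : (-a + b * Complex.I : ℂ).re < 0 := by simpa using ha
  have h := integral_exp_mul_complex_Ioi hre 0
  have hi := integrableOn_exp_mul_complex_Ioi hre 0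
  have h2 := congrArg Complex.re h
  have h3 : ∫ x in Ioi (0 : ℝ), (Complex.exp ((-a + b * Complex.I : ℂ) * x)).re
      = (∫ x in Ioi (0 : ℝ), Complex.exp ((-a + b * Complex.I : ℂ) * x)).re :=
    integral_re hi
  rw [← h3] at h2
  calc _ = ∫ x in Ioi (0 : ℝ), (Complex.exp ((-a + b * Complex.I : ℂ) * x)).re := by
        congr with x
        rw [Complex.exp_re]
        simp
    _ = _ := by
        rw [h2]
        simp [Complex.inv_re, Complex.normSq_apply, neg_div]
        ring

open Set in
/-- The Laplace transform of `x ↦ sin (b x) / x`. -/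
lemma integral_exp_neg_mul_sin_div {a : ℝ} (ha : 0 < a) (b : ℝ) :
    ∫ x in Ioi (0 : ℝ), Real.exp (-a * x) * (Real.sin (b * x) / x) = Real.arctan (b / a) := by
  -- Differentiating in `b` under the integral cancels the `1 / x` and leaves the cosine transform,
  -- which is also the derivative of `arctan (b / a)`; both functions vanish at `b = 0`.
  set F : ℝ → ℝ := fun b => ∫ x in Ioi (0 : ℝ), Real.exp (-a * x) * (Real.sin (b * x) / x)
  have hF (b : ℝ) : HasDerivAt F (a / (a ^ 2 + b ^ 2)) b := by
    rw [← integral_exp_neg_mul_cos ha b]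
    refine (hasDerivAt_integral_of_dominated_loc_of_deriv_le (s := univ)
      (F := fun c x => Real.exp (-a * x) * (Real.sin (c * x) / x))
      (F' := fun c x => Real.exp (-a * x) * Real.cos (c * x))
      (bound := fun x => Real.exp (-a * x)) univ_mem (Eventually.of_forall fun c => ?_)
      (integrableOn_exp_neg_mul_sin_div ha b) ?_ (ae_of_all _ fun x c _ => ?_)
      (integrableOn_exp_mul_Ioi (by linarith) 0) ?_).2
    · fun_prop
    · fun_prop
    · rw [norm_mul, Real.norm_eq_abs, Real.norm_eq_abs, abs_of_pos (Real.exp_pos _)]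
      exact mul_le_of_le_one_right (Real.exp_pos _).le (Real.abs_cos_le_one _)
    · refine (ae_restrict_iff' measurableSet_Ioi).2 (ae_of_all _ ?_)
      intro x (hx : 0 < x) c _
      have h1 : HasDerivAt (fun c : ℝ => c * x) x c := by
        simpa using (hasDerivAt_id c).mul_const x
      have h2 := ((h1.sin.div_const x).const_mul (Real.exp (-a * x)))
      refine h2.congr_deriv ?_
      field_simp
  have hG (b : ℝ) : HasDerivAt (fun b => F b - Real.arctan (b / a)) 0 b := by
    have h1 : HasDerivAt (fun b : ℝ => Real.arctan (b / a)) _ b :=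
      ((hasDerivAt_id b).div_const a).arctan
    refine ((hF b).sub h1).congr_deriv ?_
    have : 0 < a ^ 2 + b ^ 2 := by positivity
    simp only [id]
    field_simp
    ring
  have hc := is_const_of_deriv_eq_zero (fun b => (hG b).differentiableAt)
    (fun b => (hG b).deriv) b 0
  have h0 : F 0 = 0 := by simp [F]
  simp only [h0, zero_div, Real.arctan_zero, sub_zero] at hc
  linarith

/-! ### Characteristic functions: atom at the origin and sign inversion -/

lemma re_charFun_real (μ : Measure ℝ) [IsFiniteMeasure μ] (θ : ℝ) :
    (charFun μ θ).re = ∫ z, Real.cos (θ * z) ∂μ := by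
  rw [charFun_apply_real]
  have h : Integrable (fun z : ℝ => Complex.exp (θ * z * Complex.I)) μ :=
    Integrable.of_bound (by fun_prop) 1 (ae_of_all _ fun z => by
      rw [← Complex.ofReal_mul, Complex.norm_exp_ofReal_mul_I])
  refine (integral_re h).symm.trans ?_
  congr with z
  simpa using Complex.exp_ofReal_mul_I_re (θ * z)

lemma im_charFun_real (μ : Measure ℝ) [IsFiniteMeasure μ] (θ : ℝ) :
    (charFun μ θ).im = ∫ z, Real.sin (θ * z) ∂μ := by
  rw [charFun_apply_real]
  have h : Integrable (fun z : ℝ => Complex.exp (θ * z * Complex.I)) μ :=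
    Integrable.of_bound (by fun_prop) 1 (ae_of_all _ fun z => by
      rw [← Complex.ofReal_mul, Complex.norm_exp_ofReal_mul_I])
  refine (integral_im h).symm.trans ?_
  congr with z
  simpa using Complex.exp_ofReal_mul_I_im (θ * z)

/-- If the characteristic function of a probability measure vanishes at infinity, the measure has
no mass at the origin. -/
lemma measureReal_singleton_zero_of_tendsto_charFun {μ : Measure ℝ} [IsProbabilityMeasure μ]
    (h : Tendsto (charFun μ) atTop (𝓝 0)) : μ.real {0} = 0 := by
  -- Averaging `cos (n z θ)` against `exp (-θ)` gives `1 / (1 + (n z)²)`, which tends to the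
  -- indicator of `{0}`, while the same average of the characteristic function tends to 0.
  have key (n : ℕ) : ∫ z, 1 / (1 + ((n : ℝ) * z) ^ 2) ∂μ
      = ∫ θ in Set.Ioi (0 : ℝ), Real.exp (-1 * θ) * (charFun μ (n * θ)).re := by
    calc ∫ z, 1 / (1 + ((n : ℝ) * z) ^ 2) ∂μ
        = ∫ z, (∫ θ in Set.Ioi (0 : ℝ), Real.exp (-1 * θ) * Real.cos ((n * z) * θ)) ∂μ := by
          congr with z
          rw [integral_exp_neg_mul_cos one_pos]
          simp
      _ = ∫ θ in Set.Ioi (0 : ℝ), (∫ z, Real.exp (-1 * θ) * Real.cos ((n * z) * θ) ∂μ) := by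
          apply integral_integral_swap
          refine Integrable.mono' (g := fun p : ℝ × ℝ => 1 * Real.exp (-1 * p.2))
            (Integrable.mul_prod (f := fun _ => (1 : ℝ)) (integrable_const _)
              (integrableOn_exp_mul_Ioi (by norm_num : (-1 : ℝ) < 0) 0)) (by fun_prop)
            (ae_of_all _ fun p => ?_)
          simp only [Function.uncurry, norm_mul, Real.norm_eq_abs, abs_of_pos (Real.exp_pos _),
            one_mul]
          exact mul_le_of_le_one_right (Real.exp_pos _).le (Real.abs_cos_le_one _)
      _ = _ := by
          congr with θ
          rw [integral_const_mul, re_charFun_real]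
          congr with z
          ring_nf
  have lim1 : Tendsto (fun n : ℕ => ∫ z, 1 / (1 + ((n : ℝ) * z) ^ 2) ∂μ) atTop
      (𝓝 (∫ z, Set.indicator {0} (fun _ => (1 : ℝ)) z ∂μ)) := by
    refine tendsto_integral_of_dominated_convergence (fun _ => 1) (fun n => ?_)
      (integrable_const _) (fun n => ae_of_all _ fun z => ?_) (ae_of_all _ fun z => ?_)
    · exact (by fun_prop : Measurable _).aestronglyMeasurable
    · rw [Real.norm_eq_abs, abs_of_pos (by positivity)]
      exact (div_le_one (by positivity)).2 (by nlinarith [sq_nonneg ((n : ℝ) * z)])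
    · by_cases hz : z = 0
      · simp [hz]
      · have h1 : Tendsto (fun n : ℕ => 1 + ((n : ℝ) * z) ^ 2) atTop atTop := by
          apply tendsto_atTop_add_const_left
          simp_rw [mul_pow]
          exact ((tendsto_pow_atTop two_ne_zero).comp tendsto_natCast_atTop_atTop).atTop_mul_const
            (by positivity)
        simpa [hz, Pi.inv_def] using h1.inv_tendsto_atTop
  have lim2 : Tendsto (fun n : ℕ => ∫ θ in Set.Ioi (0 : ℝ),
      Real.exp (-1 * θ) * (charFun μ (n * θ)).re) atTop
      (𝓝 (∫ θ in Set.Ioi (0 : ℝ), (0 : ℝ))) := by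
    refine tendsto_integral_of_dominated_convergence (fun θ => Real.exp (-1 * θ)) (fun n => ?_)
      (integrableOn_exp_mul_Ioi (by norm_num : (-1 : ℝ) < 0) 0) (fun n => ae_of_all _ fun θ => ?_)
      ((ae_restrict_iff' measurableSet_Ioi).2 (ae_of_all _ fun θ (hθ : 0 < θ) => ?_))
    · have := measurable_charFun (μ := μ)
      exact (by fun_prop : Measurable _).aestronglyMeasurable
    · rw [norm_mul, Real.norm_eq_abs, Real.norm_eq_abs, abs_of_pos (Real.exp_pos _)]
      exact mul_le_of_le_one_right (Real.exp_pos _).le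
        ((Complex.abs_re_le_norm _).trans (norm_charFun_le_one _))
    · have h1 : Tendsto (fun n : ℕ => (n : ℝ) * θ) atTop atTop :=
        tendsto_natCast_atTop_atTop.atTop_mul_const hθ
      have h2 := (Complex.continuous_re.tendsto _).comp (h.comp h1)
      simpa using h2.const_mul (Real.exp (-1 * θ))
  simp_rw [key] at lim1
  have := tendsto_nhds_unique lim1 lim2
  rwa [integral_indicator (measurableSet_singleton _), setIntegral_const, integral_zero, smul_eq_mul,
    mul_one] at this

/-- The numerator vanishes to first order at 0: for `a ≤ b` the quotient is at most `(b - a) exp (-a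
θ)`. -/
lemma integrableOn_exp_sub_exp_div {a b : ℝ} (ha : 0 < a) (hb : 0 < b) :
    IntegrableOn (fun θ : ℝ => (Real.exp (-a * θ) - Real.exp (-b * θ)) / θ) (Set.Ioi 0) := by
  wlog hab : a ≤ b generalizing a b
  · refine (this hb ha (le_of_not_ge hab)).neg.congr (ae_of_all _ fun θ => ?_)
    simp only [Pi.neg_apply]
    ring
  have h1 : IntegrableOn (fun x : ℝ => (b - a) * Real.exp (-a * x)) (Set.Ioi 0) :=
    (integrableOn_exp_mul_Ioi (by linarith) 0).const_mul (b - a)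
  refine h1.mono' (by fun_prop : Measurable _).aestronglyMeasurable
    ((ae_restrict_iff' measurableSet_Ioi).2 (ae_of_all _ ?_))
  intro x (hx : 0 < x)
  have h2 : Real.exp (-b * x) = Real.exp (-a * x) * Real.exp (-(b - a) * x) := by
    rw [← Real.exp_add]; ring_nf
  have h3 : -(b - a) * x + 1 ≤ Real.exp (-(b - a) * x) := Real.add_one_le_exp _
  have h4 : Real.exp (-(b - a) * x) ≤ 1 := Real.exp_le_one_iff.2 (by nlinarith)
  have h5 := Real.exp_pos (-a * x)
  rw [norm_div, Real.norm_eq_abs, Real.norm_eq_abs, abs_of_pos hx, div_le_iff₀ hx, h2, abs_le]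
  constructor <;> nlinarith

open Set in
/-- An inversion formula for the sign of a random variable. -/
lemma integral_im_charFun_div {μ : Measure ℝ} [IsProbabilityMeasure μ]
    (h : IntegrableOn (fun θ => (charFun μ θ).im / θ) (Ioi 0)) :
    ∫ θ in Ioi (0 : ℝ), (charFun μ θ).im / θ
      = Real.pi / 2 * (μ.real (Ioi 0) - μ.real (Iio 0)) := by
  set a : ℕ → ℝ := fun n => 1 / ((n : ℝ) + 1) with ha_def
  set b : ℕ → ℝ := fun n => (n : ℝ) + 1 with hb_def
  have ha (n) : 0 < a n := by positivity
  have hb (n) : 0 < b n := by positivity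
  have hb_lim : Tendsto b atTop atTop :=
    tendsto_atTop_add_const_right _ _ tendsto_natCast_atTop_atTop
  have ha_lim : Tendsto a atTop (𝓝 0) := tendsto_one_div_add_atTop_nhds_zero_nat
  -- A single damping factor would bound the integrand only by `|z| exp (-a θ)`, and stable laws
  -- with `α < 1` have no first moment. The difference of two exponentials over `θ` is integrable
  -- uniformly in `z`, so Fubini holds for every `μ`; then `a → 0` and `b → ∞`.
  have key (n : ℕ) : ∫ z, (Real.arctan (z / a n) - Real.arctan (z / b n)) ∂μ
      = ∫ θ in Ioi (0 : ℝ), (Real.exp (-a n * θ) - Real.exp (-b n * θ)) *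
        ((charFun μ θ).im / θ) := by
    calc ∫ z, (Real.arctan (z / a n) - Real.arctan (z / b n)) ∂μ
        = ∫ z, (∫ θ in Ioi (0 : ℝ),
          (Real.exp (-a n * θ) - Real.exp (-b n * θ)) / θ * Real.sin (z * θ)) ∂μ := by
          congr with z
          rw [← integral_exp_neg_mul_sin_div (ha n), ← integral_exp_neg_mul_sin_div (hb n),
            ← integral_sub (integrableOn_exp_neg_mul_sin_div (ha n) z)
              (integrableOn_exp_neg_mul_sin_div (hb n) z)]
          congr with θ
          ring
      _ = ∫ θ in Ioi (0 : ℝ), (∫ z,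
          (Real.exp (-a n * θ) - Real.exp (-b n * θ)) / θ * Real.sin (z * θ) ∂μ) := by
          apply integral_integral_swap
          refine Integrable.mono' (g := fun p : ℝ × ℝ => 1 *
            ‖(Real.exp (-a n * p.2) - Real.exp (-b n * p.2)) / p.2‖)
            (Integrable.mul_prod (f := fun _ => (1 : ℝ)) (integrable_const _)
              (integrableOn_exp_sub_exp_div (ha n) (hb n)).norm)
            (by
              simp only [Function.uncurry_def]
              exact (by fun_prop : Measurable _).aestronglyMeasurable)
            (ae_of_all _ fun p => ?_)
          simp only [Function.uncurry, norm_mul, one_mul]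
          exact mul_le_of_le_one_right (norm_nonneg _) (Real.abs_sin_le_one _)
      _ = _ := by
          congr with θ
          rw [integral_const_mul, im_charFun_real]
          simp_rw [mul_comm θ]
          ring
  have lim1 : Tendsto (fun n : ℕ => ∫ z, (Real.arctan (z / a n) - Real.arctan (z / b n)) ∂μ) atTop
      (𝓝 (∫ z, (Ioi 0).indicator (fun _ => Real.pi / 2) z
        - (Iio 0).indicator (fun _ => Real.pi / 2) z ∂μ)) := by
    refine tendsto_integral_of_dominated_convergence (fun _ => Real.pi) (fun n => ?_)
      (integrable_const _) (fun n => ae_of_all _ fun z => ?_) (ae_of_all _ fun z => ?_)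
    · exact (by fun_prop : Measurable _).aestronglyMeasurable
    · rw [Real.norm_eq_abs, abs_le]
      constructor <;> linarith [Real.arctan_lt_pi_div_two (z / a n),
        Real.arctan_lt_pi_div_two (z / b n), Real.neg_pi_div_two_lt_arctan (z / a n),
        Real.neg_pi_div_two_lt_arctan (z / b n)]
    · have hB : Tendsto (fun n => Real.arctan (z / b n)) atTop (𝓝 0) := by
        have := (Real.continuous_arctan.tendsto 0).comp (hb_lim.const_div_atTop z)
        simpa [Function.comp_def] using this
      have hA : (fun n => Real.arctan (z / a n)) = fun n => Real.arctan (z * b n) := by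
        ext n; simp [ha_def, hb_def]
      rcases lt_trichotomy z 0 with hz | hz | hz
      · have h1 : Tendsto (fun n => Real.arctan (z * b n)) atTop (𝓝 (-(Real.pi / 2))) :=
          (Real.tendsto_arctan_atBot.mono_right nhdsWithin_le_nhds).comp
            (hb_lim.const_mul_atTop_of_neg hz)
        rw [← hA] at h1
        simpa [hz, hz.le] using h1.sub hB
      · simp [hz]
      · have h1 : Tendsto (fun n => Real.arctan (z * b n)) atTop (𝓝 (Real.pi / 2)) :=
          (Real.tendsto_arctan_atTop.mono_right nhdsWithin_le_nhds).comp
            (hb_lim.const_mul_atTop hz)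
        rw [← hA] at h1
        simpa [hz, hz.le] using h1.sub hB
  have lim2 : Tendsto (fun n : ℕ => ∫ θ in Ioi (0 : ℝ),
      (Real.exp (-a n * θ) - Real.exp (-b n * θ)) * ((charFun μ θ).im / θ)) atTop
      (𝓝 (∫ θ in Ioi (0 : ℝ), (charFun μ θ).im / θ)) := by
    refine tendsto_integral_of_dominated_convergence (fun θ => ‖(charFun μ θ).im / θ‖)
      (fun n => ?_) h.norm
      (fun n => (ae_restrict_iff' measurableSet_Ioi).2 (ae_of_all _ fun θ (hθ : 0 < θ) => ?_))
      ((ae_restrict_iff' measurableSet_Ioi).2 (ae_of_all _ fun θ (hθ : 0 < θ) => ?_))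
    · have := measurable_charFun (μ := μ)
      exact (by fun_prop : Measurable _).aestronglyMeasurable
    · rw [norm_mul]
      refine mul_le_of_le_one_left (norm_nonneg _) ?_
      have h1 : Real.exp (-a n * θ) ≤ 1 := Real.exp_le_one_iff.2 (by nlinarith [ha n])
      have h2 : Real.exp (-b n * θ) ≤ 1 := Real.exp_le_one_iff.2 (by nlinarith [hb n])
      rw [Real.norm_eq_abs, abs_le]
      constructor <;> linarith [Real.exp_pos (-a n * θ), Real.exp_pos (-b n * θ)]
    · have h1 : Tendsto (fun n => Real.exp (-a n * θ)) atTop (𝓝 1) := by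
        have := (Real.continuous_exp.tendsto _).comp (ha_lim.neg.mul_const θ)
        simpa [Function.comp_def] using this
      have h2 : Tendsto (fun n => Real.exp (-b n * θ)) atTop (𝓝 0) := by
        have h3 : Tendsto (fun n => b n * θ) atTop atTop := hb_lim.atTop_mul_const hθ
        simpa [Function.comp_def] using Real.tendsto_exp_neg_atTop_nhds_zero.comp h3
      simpa using (h1.sub h2).mul_const ((charFun μ θ).im / θ)
  simp_rw [key] at lim1
  rw [tendsto_nhds_unique lim2 lim1, integral_sub, integral_indicator measurableSet_Ioi,
    integral_indicator measurableSet_Iio, setIntegral_const, setIntegral_const, smul_eq_mul,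
    smul_eq_mul]
  · ring
  · exact (integrable_const _).indicator measurableSet_Ioi
  · exact (integrable_const _).indicator measurableSet_Iio

/-! ### Stable laws: mass of a half-line -/

open Set in
/-- The mass on the negative half-line of a strictly stable law of index `α`. -/
lemma measureReal_Iic_zero_of_charFun_eq {μ : Measure ℝ} [IsProbabilityMeasure μ] {α a b : ℝ}
    (hα : 0 < α) (ha : 0 < a) (h : ∀ θ : ℝ, 0 < θ →
      charFun μ θ = Complex.exp (-((θ ^ α : ℝ) : ℂ) * (a - b * Complex.I))) :
    μ.real (Iic 0) = 1 / 2 - Real.arctan (b / a) / (Real.pi * α) := by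
  set g : ℝ → ℝ := fun u => Real.exp (-a * u) * (Real.sin (b * u) / u) with hg
  -- Prepares `u = θ ^ α`, under which `dθ / θ = du / (α u)`; this is the source of the factor `1 /
  -- α`.
  have him (θ : ℝ) (hθ : 0 < θ) :
      (charFun μ θ).im / θ = α⁻¹ * ((|α| * θ ^ (α - 1)) • g (θ ^ α)) := by
    have hpos : 0 < θ ^ α := Real.rpow_pos_of_pos hθ α
    rw [h θ hθ, Complex.exp_im]
    simp only [Complex.neg_re, Complex.neg_im, Complex.mul_re, Complex.mul_im, Complex.sub_re,
      Complex.sub_im, Complex.ofReal_re, Complex.ofReal_im, Complex.I_re, Complex.I_im, hg,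
      smul_eq_mul, abs_of_pos hα, Real.rpow_sub_one hθ.ne']
    field_simp
    ring_nf
  have hgint : IntegrableOn g (Ioi 0) := integrableOn_exp_neg_mul_sin_div ha b
  have hint : IntegrableOn (fun θ => (charFun μ θ).im / θ) (Ioi 0) := by
    refine IntegrableOn.congr_fun (((integrableOn_Ioi_comp_rpow_iff g hα.ne').2 hgint).const_mul
      α⁻¹) (fun θ hθ => (him θ hθ).symm) measurableSet_Ioi
  have hval : ∫ θ in Ioi (0 : ℝ), (charFun μ θ).im / θ = α⁻¹ * Real.arctan (b / a) := by
    rw [setIntegral_congr_fun measurableSet_Ioi him, integral_const_mul,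
      integral_comp_rpow_Ioi g hα.ne', integral_exp_neg_mul_sin_div ha b]
  -- The inversion formula sees only `μ (0, ∞) - μ (-∞, 0)`; without an atom at 0 this determines
  -- both masses.
  have hzero : μ.real {0} = 0 := by
    refine measureReal_singleton_zero_of_tendsto_charFun ?_
    rw [tendsto_zero_iff_norm_tendsto_zero]
    have h1 : Tendsto (fun θ : ℝ => Real.exp (-(a * θ ^ α))) atTop (𝓝 0) :=
      Real.tendsto_exp_neg_atTop_nhds_zero.comp ((tendsto_rpow_atTop hα).const_mul_atTop ha)
    refine h1.congr' ?_
    filter_upwards [eventually_gt_atTop 0] with θ hθ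
    rw [h θ hθ, Complex.norm_exp]
    simp [mul_comm]
  have hsign := integral_im_charFun_div hint
  rw [hval] at hsign
  have h2 : μ.real (Iic 0) = μ.real (Iio 0) + μ.real {0} := by
    rw [← Iio_union_right, measureReal_union (by simp) (measurableSet_singleton _)]
  have h3 : μ.real (Ioi 0) = 1 - μ.real (Iic 0) := by
    rw [← compl_Iic, probReal_compl_eq_one_sub measurableSet_Iic]
  rw [h3, h2, hzero] at hsign
  rw [h2, hzero]
  have := Real.pi_pos
  field_simp at hsign ⊢
  linarith

/-- Scale and skewness are kept as separate real and imaginary coefficients of `θ ^ α`, because each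
is additive over independent sums. -/
lemma IsStableLaw.charFun_mul {α : ℝ} {μ : Measure ℝ} (hμ : IsStableLaw α μ)
    (c : ℝ) {θ : ℝ} (hθ : 0 < θ) :
    charFun μ (c * θ) = Complex.exp (-((θ ^ α : ℝ) : ℂ) * ((|c| ^ α : ℝ) -
      (Real.tan (Real.pi * α / 2) * (Real.sign c * |c| ^ α) : ℝ) * Complex.I)) := by
  rw [hμ.2, abs_mul, abs_of_pos hθ, Real.mul_rpow (abs_nonneg c) hθ.le]
  have : Real.sign (c * θ) = Real.sign c := by
    rcases lt_trichotomy c 0 with h | h | h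
    · rw [Real.sign_of_neg h, Real.sign_of_neg (mul_neg_of_neg_of_pos h hθ)]
    · simp [h]
    · rw [Real.sign_of_pos h, Real.sign_of_pos (mul_pos h hθ)]
  rw [this]
  congr 1
  push_cast
  ring

/-- A finite linear combination of independent `S(α, 1, 1)` variables is stable. -/
lemma charFun_linearCombination_of_isStableLaw {Ω ι : Type*} [MeasurableSpace Ω] {P : Measure Ω}
    {X : ι → Ω → ℝ} (hX : ∀ t, Measurable (X t)) (hind : iIndepFun X P)
    {α : ℝ} (hlaw : ∀ t, IsStableLaw α (P.map (X t))) (s : Finset ι) (c : ι → ℝ)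
    {θ : ℝ} (hθ : 0 < θ) :
    charFun (P.map (fun ω => ∑ t ∈ s, c t * X t ω)) θ =
      Complex.exp (-((θ ^ α : ℝ) : ℂ) * ((∑ t ∈ s, |c t| ^ α : ℝ) -
        (Real.tan (Real.pi * α / 2) * ∑ t ∈ s, Real.sign (c t) * |c t| ^ α : ℝ) * Complex.I)) := by
  have hind' : iIndepFun (fun t ω => c t * X t ω) P :=
    hind.comp (fun t y => c t * y) (fun t => by fun_prop)
  rw [iIndepFun.charFun_map_fun_finsetSum_eq_prod (fun t _ => by fun_prop) (hind'.restrict _),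
    Finset.prod_apply]
  have (t : ι) : charFun (P.map fun ω => c t * X t ω) θ = charFun (P.map (X t)) (c t * θ) :=
    charFun_map_mul_comp (hX t).aemeasurable _ _
  simp_rw [this, fun t => (hlaw t).charFun_mul (c t) hθ, ← Complex.exp_sum]
  congr 1
  rw [← Finset.mul_sum, Finset.sum_sub_distrib, ← Finset.sum_mul]
  push_cast
  rw [Finset.mul_sum]

lemma arctan_tan_pi_mul_div_two {α : ℝ} (hα0 : 0 < α) (hα1 : α < 1) :
    Real.arctan (Real.tan (Real.pi * α / 2)) = Real.pi * α / 2 := by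
  have := Real.pi_pos
  exact Real.arctan_tan (by nlinarith) (by nlinarith)

/-- `S(α, 1, 1)` is carried by the positive half-line when `0 < α < 1`. -/
lemma IsStableLaw.measureReal_Iic_zero {α : ℝ} {μ : Measure ℝ} (hμ : IsStableLaw α μ)
    (hα0 : 0 < α) (hα1 : α < 1) : μ.real (Set.Iic 0) = 0 := by
  have := hμ.1
  rw [measureReal_Iic_zero_of_charFun_eq (a := 1) (b := Real.tan (Real.pi * α / 2)) hα0 one_pos
    fun θ hθ => ?_]
  -- At skewness 1 the arctangent undoes the tangent and the mass is `1/2 - 1/2`.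
  · rw [div_one, arctan_tan_pi_mul_div_two hα0 hα1]
    have := Real.pi_pos
    field_simp
    norm_num
  · simpa using hμ.charFun_mul 1 hθ

/-- The probability that a positive combination of independent `S(α, 1, 1)` variables is at most
`ε` times another one. -/
lemma measureReal_sum_le_mul_of_isStableLaw {Ω ι : Type*} [MeasurableSpace Ω]
    {P : Measure Ω} [IsProbabilityMeasure P]
    {X : ι → Ω → ℝ} (hX : ∀ t, Measurable (X t)) (hind : iIndepFun X P)
    {α : ℝ} (hα : 0 < α) (hlaw : ∀ t, IsStableLaw α (P.map (X t)))
    {A : Finset ι} {i : ι} (hi : i ∉ A) {w : ι → ℝ} (hw : ∀ t ∈ A, 0 < w t) {ε : ℝ} (hε : 0 < ε) :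
    P.real {ω | ∑ t ∈ A, w t * X t ω ≤ ε * X i ω} = 1 / 2 - Real.arctan
      (((∑ t ∈ A, w t ^ α) - ε ^ α) / ((∑ t ∈ A, w t ^ α) + ε ^ α) *
        Real.tan (Real.pi * α / 2)) / (Real.pi * α) := by
  classical
  -- Moving `ε * X i` to the left turns the event into `{Z ≤ 0}`, where the negative coefficient
  -- `-ε` counts against the skewness.
  set c : ι → ℝ := fun t => if t = i then -ε else w t with hc
  have hci : c i = -ε := by simp [hc]
  have hcA : ∀ t ∈ A, c t = w t := fun t ht => by
    have : t ≠ i := by rintro rfl; exact hi ht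
    simp [hc, this]
  have hZ : Measurable (fun ω => ∑ t ∈ insert i A, c t * X t ω) := by fun_prop
  have := Measure.isProbabilityMeasure_map (μ := P) hZ.aemeasurable
  have hset : {ω | ∑ t ∈ A, w t * X t ω ≤ ε * X i ω}
      = (fun ω => ∑ t ∈ insert i A, c t * X t ω) ⁻¹' Set.Iic 0 := by
    ext ω
    simp only [Set.mem_ofPred_eq, Set.mem_preimage, Set.mem_Iic, Finset.sum_insert hi, hci]
    rw [Finset.sum_congr rfl fun t ht => congrArg (· * X t ω) (hcA t ht)]
    constructor <;> intro h <;> linarith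
  have h1 : ∑ t ∈ insert i A, |c t| ^ α = (∑ t ∈ A, w t ^ α) + ε ^ α := by
    rw [Finset.sum_insert hi, hci, abs_neg, abs_of_pos hε, add_comm]
    congr 1
    exact Finset.sum_congr rfl fun t ht => by rw [hcA t ht, abs_of_pos (hw t ht)]
  have h2 : ∑ t ∈ insert i A, Real.sign (c t) * |c t| ^ α = (∑ t ∈ A, w t ^ α) - ε ^ α := by
    rw [Finset.sum_insert hi, hci, abs_neg, abs_of_pos hε, Real.sign_of_neg (by linarith),
      neg_one_mul, neg_add_eq_sub]
    congr 1
    exact Finset.sum_congr rfl fun t ht => by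
      rw [hcA t ht, abs_of_pos (hw t ht), Real.sign_of_pos (hw t ht), one_mul]
  have hpos : 0 < (∑ t ∈ A, w t ^ α) + ε ^ α :=
    add_pos_of_nonneg_of_pos
      (Finset.sum_nonneg fun t ht => (Real.rpow_pos_of_pos (hw t ht) α).le)
      (Real.rpow_pos_of_pos hε α)
  rw [hset, ← map_measureReal_apply hZ measurableSet_Iic,
    measureReal_Iic_zero_of_charFun_eq (a := (∑ t ∈ A, w t ^ α) + ε ^ α)
      (b := Real.tan (Real.pi * α / 2) * ((∑ t ∈ A, w t ^ α) - ε ^ α)) hα hpos fun θ hθ => ?_]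
  · congr 3
    ring
  · rw [charFun_linearCombination_of_isStableLaw hX hind hlaw _ _ hθ, h1, h2]

/-! ### The limit `α → 0+` -/

lemma tendsto_arctan_mul_tan_div {u : ℝ → ℝ} {l : ℝ} (hu : Tendsto u (𝓝[>] 0) (𝓝 l)) :
    Tendsto (fun α : ℝ => Real.arctan (u α * Real.tan (Real.pi * α / 2)) / (Real.pi * α))
      (𝓝[>] 0) (𝓝 (l / 2)) := by
  -- Writing `arctan x = x * g x` with `g` continuous at 0 and `g 0 = 1` avoids dividing by `u α`,
  -- which may vanish.
  set g : ℝ → ℝ := dslope Real.arctan 0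
  have hg : ContinuousAt g 0 := continuousAt_dslope_same.2 (Real.differentiable_arctan 0)
  have hg0 : g 0 = 1 := by
    rw [show g 0 = deriv Real.arctan 0 from dslope_same _ _, Real.deriv_arctan]; simp
  have harc (x : ℝ) : Real.arctan x = x * g x := by
    have := sub_smul_dslope Real.arctan 0 x
    simpa using this.symm
  have hd : HasDerivAt (fun α : ℝ => Real.tan (Real.pi * α / 2)) (Real.pi / 2) 0 := by
    have h1 : HasDerivAt (fun α : ℝ => Real.pi * α / 2) (Real.pi / 2) 0 := by
      simpa using ((hasDerivAt_id (0 : ℝ)).const_mul Real.pi).div_const 2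
    have h2 : HasDerivAt Real.tan (1 / Real.cos (Real.pi * 0 / 2) ^ 2) (Real.pi * 0 / 2) :=
      Real.hasDerivAt_tan (by simp)
    simpa [Function.comp_def] using h2.comp 0 h1
  have hslope : Tendsto (fun α : ℝ => Real.tan (Real.pi * α / 2) / α) (𝓝[>] 0)
      (𝓝 (Real.pi / 2)) := by
    have := (hasDerivAt_iff_tendsto_slope.1 hd).mono_left
      (nhdsWithin_mono 0 fun x (hx : 0 < x) => hx.ne')
    refine this.congr fun α => ?_
    simp [slope_def_field]
  have htan : Tendsto (fun α : ℝ => Real.tan (Real.pi * α / 2)) (𝓝[>] 0) (𝓝 0) := by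
    have := hd.continuousAt.tendsto.mono_left (nhdsWithin_le_nhds (s := Set.Ioi 0))
    simpa using this
  have hgl : Tendsto (fun α : ℝ => g (u α * Real.tan (Real.pi * α / 2))) (𝓝[>] 0) (𝓝 1) := by
    rw [← hg0]
    exact hg.tendsto.comp (by simpa using hu.mul htan)
  have := ((hu.mul hslope).mul hgl).div_const Real.pi
  have hpi := Real.pi_pos
  have h3 : l * (Real.pi / 2) * 1 / Real.pi = l / 2 := by field_simp
  rw [h3] at this
  refine this.congr fun α => ?_
  rw [harc]
  simp only [div_eq_mul_inv, mul_inv]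
  ring

lemma tendsto_half_sub_arctan {ι : Type*} (A : Finset ι) {w : ι → ℝ} (hw : ∀ t ∈ A, 0 < w t)
    {ε : ℝ} (hε : 0 < ε) :
    Tendsto (fun α : ℝ => 1 / 2 - Real.arctan
      (((∑ t ∈ A, w t ^ α) - ε ^ α) / ((∑ t ∈ A, w t ^ α) + ε ^ α) *
        Real.tan (Real.pi * α / 2)) / (Real.pi * α)) (𝓝[>] 0) (𝓝 (1 / (A.card + 1))) := by
  have hpow {y : ℝ} (hy : 0 < y) : Tendsto (fun α : ℝ => y ^ α) (𝓝[>] 0) (𝓝 1) := by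
    have := (Real.continuousAt_const_rpow (b := 0) hy.ne').tendsto.mono_left
      (nhdsWithin_le_nhds (s := Set.Ioi 0))
    simpa using this
  have hsum : Tendsto (fun α : ℝ => ∑ t ∈ A, w t ^ α) (𝓝[>] 0) (𝓝 A.card) := by
    have := tendsto_finsetSum A fun t ht => hpow (hw t ht)
    simpa using this
  have hu := (hsum.sub (hpow hε)).div (hsum.add (hpow hε)) (by positivity)
  have := (tendsto_arctan_mul_tan_div hu).const_sub (1 / 2)
  have h2 : (1 / (A.card + 1) : ℝ) = 1 / 2 - ((A.card : ℝ) - 1) / (A.card + 1) / 2 := by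
    field_simp
    ring
  rw [h2]
  exact this

/-! ### Independence of blocks -/

/-- Grouping independent random variables into blocks gives independent random vectors. -/
lemma iIndepFun_curry {Ω ι : Type*} [MeasurableSpace Ω] {P : Measure Ω} {κ : ι → Type*}
    {𝓧 : (i : ι) → κ i → Type*} {m𝓧 : ∀ i j, MeasurableSpace (𝓧 i j)}
    {X : (i : ι) → (j : κ i) → Ω → 𝓧 i j} (mX : ∀ i j, Measurable (X i j))
    (h : iIndepFun (fun (p : (i : ι) × (κ i)) ω ↦ X p.1 p.2 ω) P) :
    iIndepFun (fun i ω ↦ (X i · ω)) P := by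
  have := h.isProbabilityMeasure
  have : ∀ i j, IsProbabilityMeasure (P.map (X i j)) :=
    fun i j ↦ Measure.isProbabilityMeasure_map (mX i j).aemeasurable
  have hrow (i : ι) : iIndepFun (X i) P :=
    h.precomp (g := fun j : κ i => (⟨i, j⟩ : (i : ι) × κ i)) sigma_mk_injective
  have hcomp : (MeasurableEquiv.piCurry 𝓧) ∘ (fun ω p ↦ X p.1 p.2 ω) = fun ω i j ↦ X i j ω := by
    ext; simp [Sigma.curry]
  rw [iIndepFun_iff_map_fun_eq_infinitePi_map (by fun_prop), ← hcomp,
    ← Measure.map_map (by fun_prop) (by fun_prop),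
    (iIndepFun_iff_map_fun_eq_infinitePi_map (by fun_prop)).1 h,
    Measure.infinitePi_map_piCurry (fun i j ↦ P.map (X i j))]
  congrm Measure.infinitePi fun i ↦ ?_
  rw [(iIndepFun_iff_map_fun_eq_infinitePi_map (by fun_prop)).1 (hrow i)]

lemma indepFun_of_iIndepFun_sumElim {Ω ι β : Type*} [MeasurableSpace Ω] [MeasurableSpace β]
    {P : Measure Ω} {s r : ι → Ω → β} (hs : ∀ t, Measurable (s t))
    (hr : ∀ t, Measurable (r t)) (h : iIndepFun (Sum.elim s r) P) :
    IndepFun (fun ω t => s t ω) (fun ω t => r t ω) P := by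
  let X : Bool → ι → Ω → β := fun b => cond b s r
  have hg : Function.Injective
      (fun p : (_ : Bool) × ι => if p.1 then (Sum.inl p.2 : ι ⊕ ι) else Sum.inr p.2) := by
    rintro ⟨_ | _, t⟩ ⟨_ | _, t'⟩ h <;> simp_all
  have hX : iIndepFun (fun (p : (_ : Bool) × ι) ω => X p.1 p.2 ω) P := by
    have := h.precomp hg
    refine (iIndepFun_congr ?_).1 this
    rintro ⟨_ | _, t⟩ <;> exact ae_of_all _ fun ω => rfl
  exact (iIndepFun_curry (X := X) (by rintro (_ | _) t; exacts [hr t, hs t]) hX).indepFun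
    (i := true) (j := false) (by simp)

/-! ### Bernoulli masks and a single column -/

/-- The mean of `1 / (B + 1)` for a binomial variable `B`, written as a sum over subsets. -/
lemma sum_powerset_binomial_div {ι : Type*} (S : Finset ι) (γ : ℝ) :
    ∑ A ∈ S.powerset, γ ^ (A.card + 1) * (1 - γ) ^ (S.card - A.card) * (1 / ((A.card : ℝ) + 1))
      = 1 / ((S.card + 1 : ℕ) : ℝ) * (1 - (1 - γ) ^ (S.card + 1)) := by
  rw [Finset.sum_powerset_apply_card
    (fun k => γ ^ (k + 1) * (1 - γ) ^ (S.card - k) * (1 / ((k : ℝ) + 1)))]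
  set n := S.card
  have h := add_pow γ (1 - γ) (n + 1)
  -- Dropping the `k = 0` term of `(γ + (1 - γ)) ^ (n + 1) = 1` leaves `1 - (1 - γ) ^ (n + 1)`; the
  -- remaining terms match through `C(n, k) / (k + 1) = C(n + 1, k + 1) / (n + 1)`.
  rw [Finset.sum_range_succ', add_sub_cancel, one_pow] at h
  simp only [pow_zero, Nat.sub_zero, Nat.choose_zero_right, Nat.cast_one, mul_one, one_mul,
    Nat.add_sub_add_right] at h
  rw [sub_eq_of_eq_add h, Finset.mul_sum]
  refine Finset.sum_congr rfl fun k _ => ?_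
  have h1 : ((n : ℝ) + 1) * n.choose k = (n + 1).choose (k + 1) * (k + 1) := by
    exact_mod_cast Nat.add_one_mul_choose_eq n k
  push_cast
  rw [nsmul_eq_mul]
  field_simp
  linear_combination γ ^ (k + 1) * (1 - γ) ^ (n - k) * h1

lemma ae_eq_zero_or_one {Ω : Type*} [MeasurableSpace Ω] {P : Measure Ω}
    [IsProbabilityMeasure P] {r : Ω → ℝ} {γ : ℝ} (hr : Measurable r) (h1 : P.real {ω | r ω = 1} = γ)
    (h0 : P.real {ω | r ω = 0} = 1 - γ) : ∀ᵐ ω ∂P, r ω = 0 ∨ r ω = 1 := by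
  have hm0 : MeasurableSet {ω | r ω = 0} := hr (measurableSet_singleton 0)
  have hm1 : MeasurableSet {ω | r ω = 1} := hr (measurableSet_singleton 1)
  have hd : Disjoint {ω | r ω = 0} {ω | r ω = 1} := by
    rw [Set.disjoint_left]
    intro ω (h : r ω = 0) (h' : r ω = 1)
    linarith
  have h := measureReal_union (μ := P) hd hm1
  rw [h0, h1, sub_add_cancel] at h
  have := (prob_compl_eq_zero_iff (μ := P) (hm0.union hm1)).2 (by
    rw [← ENNReal.toReal_eq_one_iff]; exact h)
  exact this

/-- The event that the mask `r` selects `i` and, among the indices in `S`, exactly those in `A`. -/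
def maskPattern {Ω ι : Type*} [DecidableEq ι] (r : ι → Ω → ℝ) (i : ι)
    (S A : Finset ι) : Set Ω :=
  ⋂ t ∈ insert i S, r t ⁻¹' {if t ∈ insert i A then 1 else 0}

lemma mem_maskPattern {Ω ι : Type*} [DecidableEq ι] {r : ι → Ω → ℝ}
    {i : ι} {S A : Finset ι} {ω : Ω} :
    ω ∈ maskPattern r i S A ↔ ∀ t ∈ insert i S, r t ω = if t ∈ insert i A then 1 else 0 := by
  simp only [maskPattern, Set.mem_iInter, Set.mem_preimage, Set.mem_singleton_iff]

/-- The exponent `A.card + 1` includes the factor `γ` for the index `i` itself. -/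
lemma measureReal_maskPattern {Ω ι : Type*} [DecidableEq ι] [MeasurableSpace Ω]
    {P : Measure Ω} {r : ι → Ω → ℝ} {γ : ℝ} (hind : iIndepFun r P)
    (h1 : ∀ t, P.real {ω | r t ω = 1} = γ) (h0 : ∀ t, P.real {ω | r t ω = 0} = 1 - γ)
    {i : ι} {S A : Finset ι} (hi : i ∉ S) (hA : A ⊆ S) :
    P.real (maskPattern r i S A) = γ ^ (A.card + 1) * (1 - γ) ^ (S.card - A.card) := by
  rw [maskPattern, measureReal_def,
    hind.measure_inter_preimage_eq_mul _ (fun t _ => measurableSet_singleton _),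
    ENNReal.toReal_prod]
  have hval (t : ι) : (P (r t ⁻¹' {if t ∈ insert i A then 1 else 0})).toReal
      = if t ∈ insert i A then γ else 1 - γ := by
    split_ifs
    · exact h1 t
    · exact h0 t
  simp_rw [hval]
  rw [Finset.prod_ite, Finset.prod_const, Finset.prod_const, Finset.filter_mem_eq_inter,
    Finset.inter_eq_right.2 (Finset.insert_subset_insert i hA),
    Finset.card_insert_of_notMem fun h => hi (hA h), Finset.filter_notMem_eq_sdiff,
    Finset.card_sdiff_of_subset (Finset.insert_subset_insert i hA),
    Finset.card_insert_of_notMem fun h => hi (hA h), Finset.card_insert_of_notMem hi,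
    Nat.add_sub_add_right]

lemma sum_mul_eq_of_mem_maskPattern {Ω ι : Type*} [Fintype ι] [DecidableEq ι]
    {s r : ι → Ω → ℝ} {x : ι → ℝ} {i : ι} {A : Finset ι} {ω : Ω}
    (hA : A ⊆ Finset.univ.filter fun t => t ≠ i ∧ x t ≠ 0)
    (hω : ω ∈ maskPattern r i (Finset.univ.filter fun t => t ≠ i ∧ x t ≠ 0) A) :
    ∑ t, x t * (s t ω * r t ω) = x i * s i ω + ∑ t ∈ A, x t * s t ω := by
  rw [mem_maskPattern] at hω
  have hi : r i ω = 1 := by simpa using hω i (Finset.mem_insert_self _ _)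
  rw [← Finset.add_sum_erase _ _ (Finset.mem_univ i), hi, mul_one]
  congr 1
  symm
  have hsub : A ⊆ Finset.univ.erase i := fun t ht => by
    simpa using (Finset.mem_filter.1 (hA ht)).2.1
  rw [← Finset.sum_subset hsub fun t hti htA => ?_]
  · refine Finset.sum_congr rfl fun t ht => ?_
    rw [hω t (Finset.mem_insert_of_mem (hA ht)), if_pos (Finset.mem_insert_of_mem ht), mul_one]
  · by_cases hxt : x t = 0
    · simp [hxt]
    · have hne : t ≠ i := Finset.ne_of_mem_erase hti
      rw [hω t (Finset.mem_insert_of_mem (by simp [hne, hxt])), if_neg (by simp [hne, htA]),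
        mul_zero, mul_zero]

/-- The probability that one column of the design certifies `x i + ε` as an upper bound. -/
lemma measureReal_ratio_le {Ω ι : Type*} [Fintype ι] [DecidableEq ι] [MeasurableSpace Ω]
    {P : Measure Ω} [IsProbabilityMeasure P] {s r : ι → Ω → ℝ} {γ : ℝ} {x : ι → ℝ} {ε : ℝ} (hs : ∀ t, Measurable (s t))
    (hr : ∀ t, Measurable (r t)) (hind : iIndepFun (Sum.elim s r) P)
    (h1 : ∀ t, P.real {ω | r t ω = 1} = γ) (h0 : ∀ t, P.real {ω | r t ω = 0} = 1 - γ)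
    (i : ι) (hpos : ∀ᵐ ω ∂P, 0 < s i ω) :
    P.real {ω | r i ω = 1 ∧ (∑ t, x t * (s t ω * r t ω)) / (s i ω * r i ω) ≤ x i + ε}
      = ∑ A ∈ (Finset.univ.filter fun t => t ≠ i ∧ x t ≠ 0).powerset,
        γ ^ (A.card + 1) *
          (1 - γ) ^ ((Finset.univ.filter fun t => t ≠ i ∧ x t ≠ 0).card - A.card) *
          P.real {ω | ∑ t ∈ A, x t * s t ω ≤ ε * s i ω} := by
  set S := Finset.univ.filter fun t => t ≠ i ∧ x t ≠ 0 with hS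
  have hiS : i ∉ S := by simp [hS]
  have hmask (A : Finset ι) : MeasurableSet (maskPattern r i S A) :=
    Finset.measurableSet_biInter _ fun t _ => hr t (measurableSet_singleton _)
  have hE (A : Finset ι) : MeasurableSet {ω | ∑ t ∈ A, x t * s t ω ≤ ε * s i ω} :=
    measurableSet_le (by fun_prop) (by fun_prop)
  have hprod (A : Finset ι) :
      P.real ({ω | ∑ t ∈ A, x t * s t ω ≤ ε * s i ω} ∩ maskPattern r i S A)
        = P.real {ω | ∑ t ∈ A, x t * s t ω ≤ ε * s i ω} * P.real (maskPattern r i S A) := by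
    have h := (indepFun_of_iIndepFun_sumElim hs hr hind).measure_inter_preimage_eq_mul
      {v : ι → ℝ | ∑ t ∈ A, x t * v t ≤ ε * v i}
      (⋂ t ∈ insert i S, (fun v : ι → ℝ => v t) ⁻¹' {if t ∈ insert i A then 1 else 0})
      (measurableSet_le (by fun_prop) (by fun_prop))
      (Finset.measurableSet_biInter _ fun t _ => measurable_pi_apply t (measurableSet_singleton _))
    have h' := congrArg ENNReal.toReal h
    rw [ENNReal.toReal_mul] at h'
    simp only [Set.preimage_iInter] at h'
    exact h'
  -- Off a null set the mask is zero-one valued and `s i > 0`, so exactly one pattern `A` occurs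
  -- when `r i = 1`; multiplying by `s i` then cancels the `x i` term.
  have hae : {ω | r i ω = 1 ∧ (∑ t, x t * (s t ω * r t ω)) / (s i ω * r i ω) ≤ x i + ε}
      =ᵐ[P] ⋃ A ∈ S.powerset,
        ({ω | ∑ t ∈ A, x t * s t ω ≤ ε * s i ω} ∩ maskPattern r i S A) := by
    have h01 : ∀ᵐ ω ∂P, ∀ t, r t ω = 0 ∨ r t ω = 1 :=
      ae_all_iff.2 fun t => ae_eq_zero_or_one (hr t) (h1 t) (h0 t)
    rw [eventuallyEq_set]
    filter_upwards [h01, hpos] with ω hω hsi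
    have key (A : Finset ι) (hA : A ⊆ S) (hmem : ω ∈ maskPattern r i S A) :
        (r i ω = 1 ∧ (∑ t, x t * (s t ω * r t ω)) / (s i ω * r i ω) ≤ x i + ε)
          ↔ ∑ t ∈ A, x t * s t ω ≤ ε * s i ω := by
      have hri : r i ω = 1 := by
        simpa using mem_maskPattern.1 hmem i (Finset.mem_insert_self _ _)
      rw [sum_mul_eq_of_mem_maskPattern hA hmem, hri, mul_one, div_le_iff₀ hsi, add_mul]
      simp
    simp only [Set.mem_iUnion, Finset.mem_powerset, Set.mem_inter_iff, exists_prop]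
    constructor
    · intro h
      refine ⟨S.filter fun t => r t ω = 1, Finset.filter_subset _ _, ?_⟩
      have hmem : ω ∈ maskPattern r i S (S.filter fun t => r t ω = 1) := by
        rw [mem_maskPattern]
        intro t ht
        rcases Finset.mem_insert.1 ht with rfl | ht
        · simpa using h.1
        · have hti : t ≠ i := by rintro rfl; exact hiS ht
          rcases hω t with h' | h' <;> simp [h', ht, hti]
      exact ⟨(key _ (Finset.filter_subset _ _) hmem).1 h, hmem⟩
    · rintro ⟨A, hA, h, hmem⟩
      exact (key A hA hmem).2 h
  rw [measureReal_congr hae, measureReal_biUnion_finset]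
  · refine Finset.sum_congr rfl fun A hA => ?_
    have hr_ind : iIndepFun r P := hind.precomp (g := Sum.inr) Sum.inr_injective
    rw [hprod, measureReal_maskPattern hr_ind h1 h0 hiS (Finset.mem_powerset.1 hA), mul_comm]
  · intro A hA B hB hAB
    rw [Function.onFun, Set.disjoint_left]
    rintro ω ⟨-, hωA⟩ ⟨-, hωB⟩
    refine hAB ?_
    simp only [Finset.coe_powerset, Set.mem_preimage, Set.mem_powerset_iff,
      Finset.coe_subset] at hA hB
    have hsub {A B : Finset ι} (hA : A ⊆ S) (hωA : ω ∈ maskPattern r i S A)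
        (hωB : ω ∈ maskPattern r i S B) : A ⊆ B := by
      intro t ht
      have hti : t ≠ i := by rintro rfl; exact hiS (hA ht)
      have e1 := mem_maskPattern.1 hωA t (Finset.mem_insert_of_mem (hA ht))
      have e2 := mem_maskPattern.1 hωB t (Finset.mem_insert_of_mem (hA ht))
      by_contra htB
      rw [e1] at e2
      simp [hti, ht, htB] at e2
    exact (hsub hA hωA hωB).antisymm (hsub hB hωB hωA)
  · exact fun A _ => (hE A).inter (hmask A)

/-! ### From one column to the whole design -/

/-- The event that column `j` of the design certifies `x i + ε` as an upper bound for `x i`. -/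
def detectionEvent {Ω : Type*} {N M : ℕ} (x : Fin N → ℝ) (s r : Fin N → Fin M → Ω → ℝ)
    (i : Fin N) (ε : ℝ) (j : Fin M) : Set Ω :=
  {ω | r i j ω = 1 ∧ (∑ t, x t * (s t j ω * r t j ω)) / (s i j ω * r i j ω) ≤ x i + ε}

/-- The infimum is over a finite set, so it is attained or, for the empty set, equals `⊤`; hence
strictness passes to and from the terms. -/
lemma lt_minEstimator_iff {N M : ℕ} (x : Fin N → ℝ) (s r : Fin N → Fin M → ℝ) (i : Fin N)
    (y : ℝ) : (y : EReal) < minEstimator x s r i ↔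
      ∀ j, r i j = 1 → y < measurement x s r j / (s i j * r i j) := by
  classical
  have h : minEstimator x s r i = (Finset.univ.filter fun j => r i j = 1).inf
      fun j => ((measurement x s r j / (s i j * r i j) : ℝ) : EReal) := by
    rw [Finset.inf_eq_iInf]
    simp [minEstimator, maskSupport]
  rw [h, Finset.lt_inf_iff (EReal.coe_lt_top y)]
  simp

namespace IsSparseStableDesign

variable {Ω : Type*} [MeasurableSpace Ω] {P : Measure Ω} {α γ : ℝ} {N M : ℕ}
  {s r : Fin N → Fin M → Ω → ℝ}

lemma iIndepFun_column (h : IsSparseStableDesign P α γ s r) (j : Fin M) :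
    iIndepFun (Sum.elim (fun t => s t j) (fun t => r t j)) P := by
  have hg : Function.Injective (Sum.map (fun t : Fin N => (t, j)) (fun t : Fin N => (t, j))) :=
    Sum.map_injective.2 ⟨fun _ _ h => (Prod.ext_iff.1 h).1, fun _ _ h => (Prod.ext_iff.1 h).1⟩
  refine (iIndepFun_congr ?_).1 (h.indep.precomp hg)
  rintro (t | t) <;> exact ae_of_all _ fun ω => rfl

/-- Both arrays are reindexed by column first, so that `iIndepFun_curry` can group the `s` and `r`
entries of a column into one vector. -/
lemma iIndepFun_columns (h : IsSparseStableDesign P α γ s r) :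
    iIndepFun (fun (j : Fin M) ω (k : Fin N ⊕ Fin N) =>
      Sum.elim (fun t => s t j ω) (fun t => r t j ω) k) P := by
  have hg : Function.Injective (fun p : (_ : Fin M) × (Fin N ⊕ Fin N) =>
      (Sum.map (fun t => (t, p.1)) (fun t => (t, p.1)) p.2 :
        (Fin N × Fin M) ⊕ (Fin N × Fin M))) := by
    rintro ⟨j, t | t⟩ ⟨j', t' | t'⟩ h <;> simp_all
  refine iIndepFun_curry (X := fun (j : Fin M) (k : Fin N ⊕ Fin N) ω =>
      Sum.elim (fun t => s t j ω) (fun t => r t j ω) k) ?_ ?_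
  · rintro j (t | t)
    exacts [h.measurable_s t j, h.measurable_r t j]
  · refine (iIndepFun_congr ?_).1 (h.indep.precomp hg)
    rintro ⟨j, t | t⟩ <;> exact ae_of_all _ fun ω => rfl

lemma measurableSet_detectionEvent (h : IsSparseStableDesign P α γ s r) (x : Fin N → ℝ)
    (i : Fin N) (ε : ℝ) (j : Fin M) : MeasurableSet (detectionEvent x s r i ε j) := by
  have hs := h.measurable_s
  have hr := h.measurable_r
  have hm : Measurable fun ω => (∑ t, x t * (s t j ω * r t j ω)) / (s i j ω * r i j ω) := by
    fun_prop
  exact (hr i j (measurableSet_singleton 1)).inter (measurableSet_le hm measurable_const)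

/-- The columns of the design being independent, the error probability factorises. -/
lemma errorProb_eq_prod [IsProbabilityMeasure P] (h : IsSparseStableDesign P α γ s r)
    (x : Fin N → ℝ) (i : Fin N) (ε : ℝ) :
    errorProb P x s r i ε = ∏ j, (1 - P.real (detectionEvent x s r i ε j)) := by
  have hset : {ω | ((x i + ε : ℝ) : EReal) <
      minEstimator x (fun t j => s t j ω) (fun t j => r t j ω) i}
      = ⋂ j ∈ Finset.univ, (fun ω (k : Fin N ⊕ Fin N) =>
        Sum.elim (fun t => s t j ω) (fun t => r t j ω) k) ⁻¹'
        {v | v (Sum.inr i) = 1 ∧ (∑ t, x t * (v (Sum.inl t) * v (Sum.inr t))) /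
          (v (Sum.inl i) * v (Sum.inr i)) ≤ x i + ε}ᶜ := by
    ext ω
    simp only [Set.mem_ofPred_eq, lt_minEstimator_iff, measurement, Set.mem_iInter,
      Finset.mem_univ, forall_const, Set.preimage_compl, Set.mem_compl_iff, Set.mem_preimage,
      Sum.elim_inl, Sum.elim_inr, not_and, not_le]
  rw [errorProb, hset, measureReal_def, h.iIndepFun_columns.measure_inter_preimage_eq_mul,
    ENNReal.toReal_prod]
  · refine Finset.prod_congr rfl fun j _ => ?_
    rw [← probReal_compl_eq_one_sub (h.measurableSet_detectionEvent x i ε j)]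
    rfl
  · intro j _
    have hm : Measurable fun v : Fin N ⊕ Fin N → ℝ =>
        (∑ t, x t * (v (Sum.inl t) * v (Sum.inr t))) / (v (Sum.inl i) * v (Sum.inr i)) := by
      fun_prop
    exact ((measurable_pi_apply _ (measurableSet_singleton 1)).inter
      (measurableSet_le hm measurable_const)).compl

lemma measureReal_detectionEvent [IsProbabilityMeasure P] (h : IsSparseStableDesign P α γ s r)
    (hα0 : 0 < α) (hα1 : α < 1) {x : Fin N → ℝ} (hx : ∀ t, 0 ≤ x t) (i : Fin N) {ε : ℝ}
    (hε : 0 < ε) (j : Fin M) :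
    P.real (detectionEvent x s r i ε j)
      = ∑ A ∈ (Finset.univ.filter fun t => t ≠ i ∧ x t ≠ 0).powerset,
        γ ^ (A.card + 1) *
          (1 - γ) ^ ((Finset.univ.filter fun t => t ≠ i ∧ x t ≠ 0).card - A.card) *
          (1 / 2 - Real.arctan (((∑ t ∈ A, x t ^ α) - ε ^ α) / ((∑ t ∈ A, x t ^ α) + ε ^ α) *
            Real.tan (Real.pi * α / 2)) / (Real.pi * α)) := by
  have hpos : ∀ᵐ ω ∂P, 0 < s i j ω := by
    have h0 := (h.law_s i j).measureReal_Iic_zero hα0 hα1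
    rw [map_measureReal_apply (h.measurable_s i j) measurableSet_Iic,
      measureReal_eq_zero_iff] at h0
    rw [ae_iff]
    simpa [Set.preimage] using h0
  rw [detectionEvent, measureReal_ratio_le (fun t => h.measurable_s t j)
    (fun t => h.measurable_r t j) (h.iIndepFun_column j) (fun t => h.prob_r_one t j)
    (fun t => h.prob_r_zero t j) i hpos]
  refine Finset.sum_congr rfl fun A hA => ?_
  have hA' : ∀ t ∈ A, t ≠ i ∧ x t ≠ 0 := fun t ht => by
    simpa using Finset.mem_powerset.1 hA ht
  rw [measureReal_sum_le_mul_of_isStableLaw (X := fun t => s t j) (fun t => h.measurable_s t j)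
    ((h.iIndepFun_column j).precomp (g := Sum.inl) Sum.inl_injective) hα0
    (fun t => h.law_s t j) (fun hi => (hA' i hi).1 rfl)
    (fun t ht => lt_of_le_of_ne (hx t) (hA' t ht).2.symm) hε]

end IsSparseStableDesign

/-! ### Counting interferers and comparing the bounds -/

lemma card_ne_and_ne_zero_add_one {N : ℕ} (x : Fin N → ℝ) (i : Fin N) :
    (Finset.univ.filter fun t => t ≠ i ∧ x t ≠ 0).card + 1
      = sparsity x + if x i = 0 then 1 else 0 := by
  have h : (Finset.univ.filter fun t => t ≠ i ∧ x t ≠ 0)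
      = (Finset.univ.filter fun t => x t ≠ 0).erase i := by
    ext t; simp
  rw [h, sparsity]
  split_ifs with hi
  · rw [Finset.erase_eq_of_notMem (by simp [hi])]
  · exact Finset.card_erase_add_one (by simp [hi])

/-- The mean of the first `n` powers of `q ∈ [0, 1]` is nonincreasing in `n`. -/
lemma one_div_mul_one_sub_pow_succ_le {q : ℝ} (hq0 : 0 ≤ q) (hq1 : q ≤ 1) {n : ℕ} (hn : n ≠ 0) :
    1 / ((n : ℝ) + 1) * (1 - q ^ (n + 1)) ≤ 1 / (n : ℝ) * (1 - q ^ n) := by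
  have hn' : 0 < (n : ℝ) := by positivity
  have h : (n : ℝ) * q ^ n ≤ ∑ k ∈ Finset.range n, q ^ k := by
    have := Finset.card_nsmul_le_sum (Finset.range n) (fun k => q ^ k) (q ^ n)
      fun k hk => pow_le_pow_of_le_one hq0 hq1 (Finset.mem_range.1 hk).le
    simpa using this
  -- With `1 - q ^ n = (1 - q) * ∑ q ^ k`, the claim is that appending `q ^ n`, which is at most
  -- every earlier term, cannot raise the mean.
  rw [← mul_neg_geom_sum, ← mul_neg_geom_sum, Finset.sum_range_succ, one_div_mul_eq_div,
    one_div_mul_eq_div, div_le_div_iff₀ (by positivity) hn']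
  have := mul_le_mul_of_nonneg_left h (sub_nonneg.2 hq1)
  nlinarith

lemma one_div_mul_one_sub_pow_le_one {q : ℝ} (hq0 : 0 ≤ q) {n : ℕ} (hn : n ≠ 0) :
    1 / (n : ℝ) * (1 - q ^ n) ≤ 1 := by
  have h1 : (1 : ℝ) ≤ n := by exact_mod_cast Nat.one_le_iff_ne_zero.2 hn
  rw [one_div_mul_eq_div, div_le_one (by positivity)]
  linarith [pow_nonneg hq0 n]

/-- Clearing denominators leaves `(1 - γ) ^ (K + 1) * (1 + K γ) ≤ 1 - γ`, which follows from
Bernoulli's inequality and `(1 - γ)(1 + γ) ≤ 1`. -/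
lemma one_div_le_one_div_mul_one_sub_pow {γ : ℝ} (hγ0 : 0 < γ) (hγ1 : γ ≤ 1) (K : ℕ) :
    1 / (1 / γ + (K : ℝ)) ≤ 1 / ((K : ℝ) + 1) * (1 - (1 - γ) ^ (K + 1)) := by
  have hb : 1 + (K : ℝ) * γ ≤ (1 + γ) ^ K := one_add_mul_le_pow (by linarith) K
  have hq : 0 ≤ (1 - γ) ^ K := pow_nonneg (by linarith) K
  have h1 : (1 - γ) ^ K * (1 + K * γ) ≤ 1 := by
    calc (1 - γ) ^ K * (1 + K * γ) ≤ (1 - γ) ^ K * (1 + γ) ^ K := by gcongr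
      _ = (1 - γ ^ 2) ^ K := by rw [← mul_pow]; ring_nf
      _ ≤ 1 := pow_le_one₀ (by nlinarith) (by nlinarith)
  have h2 : 1 / (1 / γ + (K : ℝ)) = γ / (1 + K * γ) := by field_simp
  rw [h2, one_div_mul_eq_div, div_le_div_iff₀ (by positivity) (by positivity), pow_succ]
  nlinarith [mul_le_mul_of_nonneg_right h1 (sub_nonneg.2 hγ1)]

theorem mainTheorem2 {N M K : ℕ} (x : Fin N → ℝ) (hx : ∀ t, 0 ≤ x t) (hK : sparsity x = K)
    (γ : ℝ) (hγ0 : 0 < γ) (hγ1 : γ ≤ 1) (ε : ℝ) (hε : 0 < ε)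
    {Ω : ℝ → Type*} [∀ α, MeasurableSpace (Ω α)] (P : (α : ℝ) → Measure (Ω α))
    [∀ α, IsProbabilityMeasure (P α)]
    (s r : (α : ℝ) → Fin N → Fin M → Ω α → ℝ)
    (hdesign : ∀ α, 0 < α → α < 1 → IsSparseStableDesign (P α) α γ (s α) (r α))
    (i : Fin N) :
    Tendsto (fun α : ℝ => errorProb (P α) x (s α) (r α) i ε) (𝓝[>] 0)
      (𝓝 ((1 - 1 / ((K + if x i = 0 then 1 else 0 : ℕ) : ℝ) *
        (1 - (1 - γ) ^ (K + if x i = 0 then 1 else 0 : ℕ))) ^ M)) ∧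
    (1 - 1 / ((K + if x i = 0 then 1 else 0 : ℕ) : ℝ) *
        (1 - (1 - γ) ^ (K + if x i = 0 then 1 else 0 : ℕ))) ^ M ≤
      (1 - 1 / ((K : ℝ) + 1) * (1 - (1 - γ) ^ (K + 1))) ^ M ∧
    (1 - 1 / ((K : ℝ) + 1) * (1 - (1 - γ) ^ (K + 1))) ^ M ≤
      (1 - 1 / (1 / γ + (K : ℝ))) ^ M := by
  have hγ' : 0 ≤ 1 - γ := sub_nonneg.2 hγ1
  have hcard := card_ne_and_ne_zero_add_one x i
  rw [hK] at hcard
  have hne : K + (if x i = 0 then 1 else 0) ≠ 0 := by rw [← hcard]; exact Nat.succ_ne_zero _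
  refine ⟨?_, ?_, ?_⟩
  · have hlim : Tendsto (fun α : ℝ => ∏ _j : Fin M, (1 -
        ∑ A ∈ (Finset.univ.filter fun t => t ≠ i ∧ x t ≠ 0).powerset, γ ^ (A.card + 1) *
          (1 - γ) ^ ((Finset.univ.filter fun t => t ≠ i ∧ x t ≠ 0).card - A.card) *
          (1 / 2 - Real.arctan (((∑ t ∈ A, x t ^ α) - ε ^ α) / ((∑ t ∈ A, x t ^ α) + ε ^ α) *
            Real.tan (Real.pi * α / 2)) / (Real.pi * α)))) (𝓝[>] 0)
        (𝓝 (∏ _j : Fin M, (1 -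
          ∑ A ∈ (Finset.univ.filter fun t => t ≠ i ∧ x t ≠ 0).powerset, γ ^ (A.card + 1) *
          (1 - γ) ^ ((Finset.univ.filter fun t => t ≠ i ∧ x t ≠ 0).card - A.card) *
          (1 / ((A.card : ℝ) + 1))))) := by
      refine tendsto_finsetProd _ fun j _ => (tendsto_finsetSum _ fun A hA => ?_).const_sub 1
      refine (tendsto_half_sub_arctan A (fun t ht => lt_of_le_of_ne (hx t) ?_) hε).const_mul _
      have : t ≠ i ∧ x t ≠ 0 := by simpa using Finset.mem_powerset.1 hA ht
      exact this.2.symm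
    rw [sum_powerset_binomial_div, hcard, Finset.prod_const, Finset.card_univ,
      Fintype.card_fin] at hlim
    refine hlim.congr' ?_
    filter_upwards [Ioo_mem_nhdsGT (zero_lt_one' ℝ)] with α hα
    have hd := hdesign α hα.1 hα.2
    rw [hd.errorProb_eq_prod]
    exact Finset.prod_congr rfl fun j _ => by
      rw [hd.measureReal_detectionEvent hα.1 hα.2 hx i hε j]
  · refine pow_le_pow_left₀ (sub_nonneg.2 (one_div_mul_one_sub_pow_le_one hγ' hne)) ?_ M
    -- For `x i = 0` the two bounds coincide; otherwise `K ≥ 1` and they are consecutive means.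
    by_cases hi : x i = 0
    · simp [hi]
    · simp only [hi, if_false, add_zero] at hne ⊢
      exact sub_le_sub_left (one_div_mul_one_sub_pow_succ_le hγ' (by linarith) hne) 1
  · refine pow_le_pow_left₀ ?_ (sub_le_sub_left
      (one_div_le_one_div_mul_one_sub_pow hγ0 hγ1 K) 1) M
    have := one_div_mul_one_sub_pow_le_one hγ' K.succ_ne_zero
    push_cast at this
    exact sub_nonneg.2 this
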